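/- Let $D\subset\mathbb{R}^2$ be the open unit disc, $\mathbf e(\varphi)=(\cos\varphi,\sin\varphi)$, and consider the generating function $$\Phi(x;\lambda,\varphi)=\lambda+\psi(x,\varphi),\qquad \psi(x,\varphi)=-\frac{2\langle x,\mathbf e(\varphi)\rangle}{1-|x|^2},\qquad x\in D,\ \lambda\in\mathbb{R},\ \varphi\in[0,2\pi],$$ of the family of equidistant arcs $F(\lambda,\varphi)=\{x\in D:\Phi(x;\lambda,\varphi)=0\}$. For a function $f$ on $D$ let $$M_\Phi f(\lambda,\varphi)=\int_{F(\lambda,\varphi)}\frac{f(x)\,\mathrm ds}{|\nabla_x\Phi(x;\lambda,\varphi)|}$$ be its Funk–Radon transform, where $\mathrm ds$ is the Euclidean arc length and $\nabla_x$ the Euclidean gradient. Let $f\in L_2(D)$ have compact support in $D$. Then for every $\varphi$ the integral $M_\Phi f(\lambda,\varphi)$ exists for almost every $\lambda$, and $$f(x)=-\frac{1}{\pi^2}\,\frac{1+|x|^2}{1-|x|^2}\ (P)\!\int_0^{2\pi}\!\int_{-\infty}^{\infty}\frac{M_\Phi f(\lambda,\varphi)}{\bigl((1-|x|^2)\lambda-2\langle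 x,\mathbf e(\varphi)\rangle\bigr)^2}\,\mathrm d\lambda\,\mathrm d\varphi .$$ Here $(P)\int\!\int h/T^2$ is the principal value integral, that is the limit as $\varepsilon\to0+$ of $\int\!\int h\,\operatorname{Re}\,(T+i\varepsilon)^{-2}\,\mathrm d\lambda\,\mathrm d\varphi$. For every $\varepsilon>0$ and $x\in D$ the latter integral converges absolutely; the limit exists, and the equality holds, in $L_2(D)_{\mathrm{loc}}$ (that is, in $L_2(K)$ for every compact $K\subset D$) and moreover pointwise at every $x\in D$ at which $f$ is continuous. -/

import Mathlib

open MeasureTheory Set Filter Topology Metric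
open scoped RealInnerProductSpace

noncomputable section

namespace EquidistantRadon

/-- The Euclidean plane. -/
abbrev Plane : Type := EuclideanSpace ℝ (Fin 2)

/-- The open unit disc. -/
def disc : Set Plane := ball 0 1

/-- The unit vector `e(φ) = (cos φ, sin φ)`. -/
def unitVec (φ : ℝ) : Plane := !₂[Real.cos φ, Real.sin φ]

/-- The curve `{x ∈ X : Φ(x; s, φ) = 0}` defined by a generating function `Φ` in a domain `X`. -/
def levelCurve (X : Set Plane) (Φ : Plane → ℝ → ℝ → ℝ) (s φ : ℝ) : Set Plane :=
  {x | x ∈ X ∧ Φ x s φ = 0}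

section
variable {E : Type*} [NormedAddCommGroup E] [NormedSpace ℝ E]

/-- The integrand `f / |∇ₓ Φ(x; s, φ)|` of the Funk-Radon transform (Euclidean gradient in `x`). -/
def frIntegrand (Φ : Plane → ℝ → ℝ → ℝ) (f : Plane → E) (s φ : ℝ) (x : Plane) : E :=
  ‖gradient (fun y => Φ y s φ) x‖⁻¹ • f x

/-- The Funk-Radon transform `M_Φ f (s, φ)`: the integral of `f / |∇ₓ Φ|` over the curve
`{x ∈ X : Φ(x; s, φ) = 0}` against Euclidean arc length (one-dimensional Hausdorff measure). -/
def funkRadon (X : Set Plane) (Φ : Plane → ℝ → ℝ → ℝ) (f : Plane → E) (s φ : ℝ) : E :=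
  ∫ x in levelCurve X Φ s φ, frIntegrand Φ f s φ x ∂(Measure.hausdorffMeasure 1)

/-- The regularization `Re (t + iε)⁻² = ((t + iε)⁻² + (t - iε)⁻²) / 2` of `1 / t²`. -/
def regInvSq (ε t : ℝ) : ℝ := ((((t : ℂ) + (ε : ℂ) * Complex.I) ^ 2)⁻¹).re

/-- The regularization at level `ε` of the principal value integral
`(P) ∫₀^{2π} ∫_ℝ h(s, φ) / T(x; s, φ)² ds dφ`; the principal value is its limit as `ε → 0+`. -/
def pvApprox (T : Plane → ℝ → ℝ → ℝ) (h : ℝ → ℝ → E) (ε : ℝ) (x : Plane) : E :=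
  ∫ φ in (0 : ℝ)..(2 * Real.pi), ∫ s : ℝ, regInvSq ε (T x s φ) • h s φ

end

/-- `ψ(x, φ) = -2⟨x, e(φ)⟩ / (1 - |x|²)`. -/
def psi (x : Plane) (φ : ℝ) : ℝ := -(2 * ⟪x, unitVec φ⟫) / (1 - ‖x‖ ^ 2)

/-- The generating function `Φ(x; s, φ) = s + ψ(x, φ)` of the equidistant arcs. -/
def genFun (x : Plane) (s φ : ℝ) : ℝ := s + psi x φ

/-- The expression `(1 - |x|²) s - 2⟨x, e(φ)⟩`, whose square is the denominator. -/
def denom (x : Plane) (s φ : ℝ) : ℝ := (1 - ‖x‖ ^ 2) * s - 2 * ⟪x, unitVec φ⟫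

/-- The right-hand side of the reconstruction formula, with the principal value integral
replaced by its regularization at level `ε`. -/
def reconstruction {E : Type*} [NormedAddCommGroup E] [NormedSpace ℝ E]
    (f : Plane → E) (ε : ℝ) (x : Plane) : E :=
  (-(1 / Real.pi ^ 2) * ((1 + ‖x‖ ^ 2) / (1 - ‖x‖ ^ 2))) •
    pvApprox denom (funkRadon disc genFun f) ε x

end EquidistantRadon

end

/-!
The map `y ↦ y / (1 + √(1 + |y|²))` (`chart`) is a diffeomorphism of the plane onto the disc, with
inverse `x ↦ 2x / (1 - |x|²)` (`chartInv`), and `Φ(x; s, φ) = s - ⟨chartInv x, e(φ)⟩`. In this chart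
the equidistant arcs are therefore the straight lines `⟨y, e(φ)⟩ = s`, and the theorem is the
inversion of the Radon transform of the plane in disguise.

* Hausdorff measure on an embedded curve is arc length (`hausdorffMeasure_restrict_range`), and the
  speed of an arc divided by `|∇Φ|` is the Jacobian of `chart`
  (`norm_deriv_arc_smul_frIntegrand`). Hence the Funk-Radon transform of `f` is the Radon transform
  of `pull f`, the density of the pull-back of `f dx` to the plane (`funkRadon_eq_integral_pull`).
  Fubini's theorem gives the existence of the transform on almost every arc and the absolute
  convergence of the regularized integrals.
* The integral of `Re (T + iε)⁻²` over the directions `φ` is elementary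
  (`integral_regInvSq_cos_sin`) and is, up to a constant, the Poisson kernel of the half-space
  `ℝ² × (0, ∞)`. So the regularized reconstruction at `x` is, up to the Jacobian factor, the Poisson
  integral of `pull f` at the point `chartInv x` and at the height `ε / (1 - |x|²)`
  (`reconstruction_eq_poisson`).
* Poisson integrals of an integrable function converge at its points of continuity, because the
  kernel is an approximate identity (`tendsto_poissonIntegral`). For the convergence in `L²` the
  height depends on the point, but only by a bounded factor over a compact subset of the disc; up to
  a constant the kernel is then dominated by that of constant height, so the Poisson integrals are
  uniformly bounded in `L²`, and approximation by continuous functions of compact support concludes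
  (`tendsto_eLpNorm_poissonIntegral_sub`).
-/

noncomputable section

namespace EquidistantRadon

/-! ### The chart of the disc in which the equidistant arcs are straight lines -/

/-- The Japanese bracket `√(1 + |y|²)`. -/
def bracket (y : Plane) : ℝ := √(1 + ‖y‖ ^ 2)

/-- The diffeomorphism `y ↦ y / (1 + √(1 + |y|²))` of the plane onto the unit disc, inverse to
`x ↦ 2x / (1 - |x|²)`. -/
def chart (y : Plane) : Plane := (1 + bracket y)⁻¹ • y

/-- The inverse `x ↦ 2x / (1 - |x|²)` of `chart`. -/
def chartInv (x : Plane) : Plane := (2 / (1 - ‖x‖ ^ 2)) • x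

/-- The Jacobian determinant of `chart`. -/
def chartJac (y : Plane) : ℝ := (bracket y * (1 + bracket y) ^ 2)⁻¹

theorem bracket_sq (y : Plane) : bracket y ^ 2 = 1 + ‖y‖ ^ 2 :=
  Real.sq_sqrt (by positivity)

theorem one_le_bracket (y : Plane) : 1 ≤ bracket y :=
  Real.one_le_sqrt.2 (by nlinarith [sq_nonneg ‖y‖])

theorem bracket_pos (y : Plane) : 0 < bracket y := one_pos.trans_le (one_le_bracket y)

theorem chartJac_pos (y : Plane) : 0 < chartJac y := by
  have := bracket_pos y
  unfold chartJac; positivity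

theorem continuous_bracket : Continuous bracket := by
  unfold bracket; fun_prop

theorem continuous_chart : Continuous chart := by
  unfold chart
  refine Continuous.smul (Continuous.inv₀ (continuous_const.add continuous_bracket) fun y => ?_)
    continuous_id
  have := bracket_pos y
  exact (by positivity : 0 < 1 + bracket y).ne'

theorem continuous_chartJac : Continuous chartJac := by
  unfold chartJac
  refine Continuous.inv₀
    (continuous_bracket.mul ((continuous_const.add continuous_bracket).pow 2)) fun y => ?_
  have := bracket_pos y
  exact (by positivity : 0 < bracket y * (1 + bracket y) ^ 2).ne'

theorem one_sub_norm_chart_sq (y : Plane) : 1 - ‖chart y‖ ^ 2 = 2 / (1 + bracket y) := by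
  have h := bracket_pos y
  have h2 := bracket_sq y
  rw [chart, norm_smul, mul_pow, Real.norm_eq_abs, sq_abs]
  field_simp
  linear_combination h2

theorem chart_mem_disc (y : Plane) : chart y ∈ disc := by
  have h := bracket_pos y
  have h1 := one_sub_norm_chart_sq y
  have h2 : 0 < 2 / (1 + bracket y) := by positivity
  rw [disc, mem_ball_zero_iff]
  nlinarith [norm_nonneg (chart y)]

theorem one_sub_norm_sq_pos {x : Plane} (hx : x ∈ disc) : 0 < 1 - ‖x‖ ^ 2 := by
  rw [disc, mem_ball_zero_iff] at hx
  nlinarith [norm_nonneg x]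

theorem chartInv_chart (y : Plane) : chartInv (chart y) = y := by
  have h := bracket_pos y
  rw [chartInv, one_sub_norm_chart_sq, chart, smul_smul]
  have : 2 / (2 / (1 + bracket y)) * (1 + bracket y)⁻¹ = 1 := by field_simp
  rw [this, one_smul]

theorem bracket_chartInv {x : Plane} (hx : x ∈ disc) :
    bracket (chartInv x) = (1 + ‖x‖ ^ 2) / (1 - ‖x‖ ^ 2) := by
  have h := one_sub_norm_sq_pos hx
  have : 1 + ‖chartInv x‖ ^ 2 = ((1 + ‖x‖ ^ 2) / (1 - ‖x‖ ^ 2)) ^ 2 := by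
    rw [chartInv, norm_smul, mul_pow, Real.norm_eq_abs, sq_abs]
    field_simp
    ring
  rw [bracket, this, Real.sqrt_sq (by positivity)]

theorem chart_chartInv {x : Plane} (hx : x ∈ disc) : chart (chartInv x) = x := by
  have h := one_sub_norm_sq_pos hx
  rw [chart, bracket_chartInv hx, chartInv, smul_smul]
  have : (1 + (1 + ‖x‖ ^ 2) / (1 - ‖x‖ ^ 2))⁻¹ * (2 / (1 - ‖x‖ ^ 2)) = 1 := by
    have h3 : 1 + (1 + ‖x‖ ^ 2) / (1 - ‖x‖ ^ 2) = 2 / (1 - ‖x‖ ^ 2) := by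
      field_simp; ring
    rw [h3]
    exact inv_mul_cancel₀ (by positivity)
  rw [this, one_smul]

theorem chart_injective : Function.Injective chart :=
  Function.LeftInverse.injective chartInv_chart

theorem image_chart_univ : chart '' univ = disc := by
  ext x
  constructor
  · rintro ⟨y, -, rfl⟩
    exact chart_mem_disc y
  · exact fun hx => ⟨chartInv x, mem_univ _, chart_chartInv hx⟩

theorem chartJac_chartInv {x : Plane} (hx : x ∈ disc) :
    chartJac (chartInv x) = (1 - ‖x‖ ^ 2) ^ 3 / (4 * (1 + ‖x‖ ^ 2)) := by
  have h := one_sub_norm_sq_pos hx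
  rw [chartJac, bracket_chartInv hx]
  have h3 : 1 + (1 + ‖x‖ ^ 2) / (1 - ‖x‖ ^ 2) = 2 / (1 - ‖x‖ ^ 2) := by
    field_simp; ring
  rw [h3]
  field_simp
  norm_num

/-- The derivative `h ↦ h / (1 + q) - ⟨y, h⟩ y / (q (1 + q)²)` of `chart`, where `q = √(1 + |y|²)`. -/
def chartDeriv (y : Plane) : Plane →L[ℝ] Plane :=
  (1 + bracket y)⁻¹ • ContinuousLinearMap.id ℝ Plane - chartJac y • (innerSL ℝ y).smulRight y

theorem chartDeriv_apply (y h : Plane) :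
    chartDeriv y h = (1 + bracket y)⁻¹ • h - (chartJac y * ⟪y, h⟫) • y := by
  simp [chartDeriv, smul_smul]

theorem hasStrictFDerivAt_chart (y : Plane) : HasStrictFDerivAt chart (chartDeriv y) y := by
  have hq := bracket_pos y
  have h1 : HasStrictFDerivAt bracket ((bracket y)⁻¹ • innerSL ℝ y) y := by
    have h := ((hasStrictFDerivAt_norm_sq y).const_add 1).sqrt (by positivity)
    convert! h using 1
    ext v
    simp [bracket]
    field_simp
  have h2 := ((hasStrictDerivAt_inv (x := 1 + bracket y) (by positivity)).comp_hasStrictFDerivAt y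
    (h1.const_add 1)).smul (hasStrictFDerivAt_id y)
  convert! h2 using 1
  ext1 v
  rw [chartDeriv_apply]
  simp [chartJac, smul_smul, sub_eq_add_neg]

theorem chartDeriv_det (y : Plane) : (chartDeriv y).det = chartJac y := by
  have hq := bracket_pos y
  have h2 := bracket_sq y
  have h3 : ‖y‖ ^ 2 = y 0 ^ 2 + y 1 ^ 2 := by
    simp [EuclideanSpace.norm_sq_eq, Fin.sum_univ_two]
  rw [h3] at h2
  rw [ContinuousLinearMap.det, ← LinearMap.det_toMatrix (EuclideanSpace.basisFun (Fin 2) ℝ).toBasis,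
    Matrix.det_fin_two]
  simp [LinearMap.toMatrix_apply, chartDeriv_apply, chartJac, PiLp.inner_apply]
  field_simp
  linear_combination (bracket y + bracket y ^ 2) * h2

section pull
variable {E : Type*} [NormedAddCommGroup E] [NormedSpace ℝ E]

/-- The density on the plane of the pull-back of `f dx` under `chart`. -/
def pull (f : Plane → E) (y : Plane) : E := chartJac y • f (chart y)

theorem abs_chartDeriv_det (y : Plane) : |(chartDeriv y).det| = chartJac y := by
  rw [chartDeriv_det, abs_of_pos (chartJac_pos y)]

theorem integrable_pull_iff (f : Plane → E) : Integrable (pull f) ↔ IntegrableOn f disc := by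
  have h := integrableOn_image_iff_integrableOn_abs_det_fderiv_smul volume MeasurableSet.univ
    (fun y _ => (hasStrictFDerivAt_chart y).hasFDerivAt.hasFDerivWithinAt)
    chart_injective.injOn f
  rw [image_chart_univ, integrableOn_univ] at h
  simp only [abs_chartDeriv_det] at h
  exact h.symm

theorem lintegral_chart_image {s : Set Plane} (hs : MeasurableSet s) (F : Plane → ENNReal) :
    ∫⁻ x in chart '' s, F x = ∫⁻ y in s, ENNReal.ofReal (chartJac y) * F (chart y) := by
  have h := lintegral_image_eq_lintegral_abs_det_fderiv_mul volume hs
    (fun y _ => (hasStrictFDerivAt_chart y).hasFDerivAt.hasFDerivWithinAt)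
    chart_injective.injOn F
  simpa only [abs_chartDeriv_det] using h

end pull

/-! ### Lines of the plane -/

/-- The unit vector `(-sin φ, cos φ)` orthogonal to `unitVec φ`. -/
def perpVec (φ : ℝ) : Plane := !₂[-Real.sin φ, Real.cos φ]

/-- The point with coordinates `s`, `t` in the orthonormal frame `unitVec φ`, `perpVec φ`. -/
def framePoint (φ s t : ℝ) : Plane := s • unitVec φ + t • perpVec φ

theorem inner_framePoint_unitVec (φ s t : ℝ) : ⟪framePoint φ s t, unitVec φ⟫ = s := by
  simp [framePoint, unitVec, perpVec, PiLp.inner_apply, Fin.sum_univ_two]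
  linear_combination s * Real.sin_sq_add_cos_sq φ

theorem inner_framePoint_perpVec (φ s t : ℝ) : ⟪framePoint φ s t, perpVec φ⟫ = t := by
  simp [framePoint, unitVec, perpVec, PiLp.inner_apply, Fin.sum_univ_two]
  linear_combination t * Real.sin_sq_add_cos_sq φ

theorem norm_framePoint_sq (φ s t : ℝ) : ‖framePoint φ s t‖ ^ 2 = s ^ 2 + t ^ 2 := by
  simp [framePoint, unitVec, perpVec, EuclideanSpace.norm_sq_eq, Fin.sum_univ_two]
  linear_combination (s ^ 2 + t ^ 2) * Real.sin_sq_add_cos_sq φ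

theorem norm_unitVec (φ : ℝ) : ‖unitVec φ‖ = 1 := by
  have := norm_framePoint_sq φ 1 0
  rw [framePoint, one_smul, zero_smul, add_zero] at this
  nlinarith [norm_nonneg (unitVec φ)]

theorem norm_perpVec (φ : ℝ) : ‖perpVec φ‖ = 1 := by
  have := norm_framePoint_sq φ 0 1
  rw [framePoint, one_smul, zero_smul, zero_add] at this
  nlinarith [norm_nonneg (perpVec φ)]

theorem framePoint_inner (φ : ℝ) (y : Plane) :
    framePoint φ ⟪y, unitVec φ⟫ ⟪y, perpVec φ⟫ = y := by
  ext i
  fin_cases i <;> simp [framePoint, unitVec, perpVec, PiLp.inner_apply, Fin.sum_univ_two]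
  · linear_combination y 0 * Real.sin_sq_add_cos_sq φ
  · linear_combination y 1 * Real.sin_sq_add_cos_sq φ

theorem continuous_framePoint : Continuous fun p : ℝ × ℝ × ℝ => framePoint p.1 p.2.1 p.2.2 := by
  unfold framePoint unitVec perpVec
  fun_prop

theorem measurePreserving_framePoint (φ : ℝ) :
    MeasurePreserving (fun p : ℝ × ℝ => framePoint φ p.1 p.2) := by
  let L : Plane →ₗᵢ[ℝ] Plane :=
    { toFun := fun y => framePoint φ (y 0) (y 1)
      map_add' := fun x y => by simp [framePoint, add_smul]; abel
      map_smul' := fun c y => by simp [framePoint, mul_smul]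
      norm_map' := fun y => by
        have h := norm_framePoint_sq φ (y 0) (y 1)
        have h3 : ‖y‖ ^ 2 = y 0 ^ 2 + y 1 ^ 2 := by
          simp [EuclideanSpace.norm_sq_eq, Fin.sum_univ_two]
        rw [← h3] at h
        exact (sq_eq_sq₀ (norm_nonneg _) (norm_nonneg _)).1 h }
  have h1 := (L.toLinearIsometryEquiv rfl).measurePreserving
  have h2 := PiLp.volume_preserving_toLp (Fin 2)
  have h3 := (volume_preserving_finTwoArrow ℝ).symm
  exact h1.comp (h2.comp h3)

/-! ### One-dimensional Hausdorff measure on a curve -/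

section curve
open scoped NNReal ENNReal
variable {F : Type*} [NormedAddCommGroup F] [NormedSpace ℝ F]

/-- Near a parameter at which its speed exceeds `k`, a curve expands distances by at least `k`. -/
theorem exists_nhds_mul_norm_sub_le {γ : ℝ → F} {v : F} {t : ℝ} (h : HasStrictDerivAt γ v t)
    {k : ℝ} (hk : k < ‖v‖) :
    ∃ U ∈ 𝓝 t, ∀ a ∈ U, ∀ b ∈ U, k * ‖a - b‖ ≤ ‖γ a - γ b‖ := by
  have h1 : ∀ᶠ p : ℝ × ℝ in 𝓝 (t, t),
      ‖γ p.1 - γ p.2 - (p.1 - p.2) • v‖ ≤ (‖v‖ - k) * ‖p.1 - p.2‖ := by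
    have := (HasStrictFDerivAt.isLittleO h).def (sub_pos.2 hk)
    simpa using this
  obtain ⟨U, hU, tU, hUp⟩ := exists_nhds_square h1
  refine ⟨U, hU.mem_nhds tU, fun a ha b hb => ?_⟩
  have h2 := hUp (mk_mem_prod ha hb)
  simp only [mem_ofPred_eq] at h2
  have h3 : ‖(a - b) • v‖ ≤ ‖γ a - γ b‖ + ‖γ a - γ b - (a - b) • v‖ := by
    have := norm_sub_le (γ a - γ b) (γ a - γ b - (a - b) • v)
    simpa using this
  rw [norm_smul] at h3
  nlinarith

variable [MeasurableSpace F] [BorelSpace F]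

theorem exists_nhds_hausdorffMeasure_image_le {γ : ℝ → F} {v : F} {t : ℝ}
    (h : HasStrictDerivAt γ v t) {K : ℝ≥0} (hK : ‖v‖₊ < K) :
    ∃ U ∈ 𝓝 t, ∀ S ⊆ U, Measure.hausdorffMeasure 1 (γ '' S) ≤ K * volume S := by
  obtain ⟨U, hU, hL⟩ := HasStrictFDerivAt.exists_lipschitzOnWith_of_nnnorm_lt h K (by simpa using hK)
  refine ⟨U, hU, fun S hS => ?_⟩
  have := (hL.mono hS).hausdorffMeasure_image_le zero_le_one
  simpa [hausdorffMeasure_real] using this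

theorem exists_nhds_le_hausdorffMeasure_image {γ : ℝ → F} (hγ : Function.Injective γ) {v : F}
    {t : ℝ} (h : HasStrictDerivAt γ v t) {k : ℝ≥0} (hk : k < ‖v‖₊) :
    ∃ U ∈ 𝓝 t, ∀ S ⊆ U, k * volume S ≤ Measure.hausdorffMeasure 1 (γ '' S) := by
  rcases eq_or_ne k 0 with rfl | hk0
  · exact ⟨univ, univ_mem, fun S _ => by simp⟩
  obtain ⟨U, hU, hL⟩ := exists_nhds_mul_norm_sub_le h (k := k) (by exact_mod_cast hk)
  refine ⟨U, hU, fun S hS => ?_⟩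
  have hkpos : 0 < (k : ℝ) := by positivity
  -- the inverse of the curve is Lipschitz with constant `1 / k` on the image of `S`
  have h1 : LipschitzOnWith k⁻¹ (Function.invFun γ) (γ '' S) := by
    refine LipschitzOnWith.of_dist_le_mul ?_
    rintro _ ⟨a, ha, rfl⟩ _ ⟨b, hb, rfl⟩
    rw [Function.leftInverse_invFun hγ, Function.leftInverse_invFun hγ, dist_eq_norm, dist_eq_norm,
      NNReal.coe_inv, ← div_eq_inv_mul, le_div_iff₀ hkpos, mul_comm]
    exact hL a (hS ha) b (hS hb)
  have h2 := h1.hausdorffMeasure_image_le zero_le_one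
  have h3 : Function.invFun γ '' (γ '' S) = S := by
    rw [← image_comp, Function.invFun_comp hγ, image_id]
  rw [h3, hausdorffMeasure_real, ENNReal.rpow_one] at h2
  calc (k : ℝ≥0∞) * volume S
      ≤ k * ((k⁻¹ : ℝ≥0) * Measure.hausdorffMeasure 1 (γ '' S)) := by gcongr
    _ = Measure.hausdorffMeasure 1 (γ '' S) := by
      rw [← mul_assoc, ← ENNReal.coe_mul, mul_inv_cancel₀ hk0, ENNReal.coe_one, one_mul]

/-- Arc length is Hausdorff measure: on a `C¹` embedded curve `γ` the one-dimensional Hausdorff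
measure is `|γ'| dt`. The ratio of the measure of a short arc to its parameter length tends to the
speed, so the differentiation theorem for measures identifies the density. -/
theorem hausdorffMeasure_restrict_range {γ γ' : ℝ → F} (hγ : Function.Injective γ)
    (h : ∀ t, HasStrictDerivAt γ (γ' t) t) :
    (Measure.hausdorffMeasure 1 : Measure F).restrict (range γ) =
      (volume.withDensity fun t => ‖γ' t‖ₑ).map γ := by
  have hcont : Continuous γ := continuous_iff_continuousAt.2 fun t => (h t).hasDerivAt.continuousAt
  have hemb : MeasurableEmbedding γ := hcont.measurableEmbedding hγ
  set μ : Measure ℝ := (Measure.hausdorffMeasure 1 : Measure F).comap γ with hμ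
  have happ (S : Set ℝ) : μ S = Measure.hausdorffMeasure 1 (γ '' S) := hemb.comap_apply _ _
  rw [← hemb.map_comap, ← hμ]
  congr 1
  have hlf : IsLocallyFiniteMeasure μ := by
    refine ⟨fun t => ?_⟩
    obtain ⟨U, hU, hle⟩ := exists_nhds_hausdorffMeasure_image_le (h t) (lt_add_one _)
    refine ⟨U ∩ closedBall t 1, inter_mem hU (closedBall_mem_nhds _ one_pos), ?_⟩
    rw [happ]
    refine (hle _ inter_subset_left).trans_lt (ENNReal.mul_lt_top ENNReal.coe_lt_top ?_)
    exact (measure_mono inter_subset_right).trans_lt measure_closedBall_lt_top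
  have hac : μ ≪ volume := by
    intro S hS
    refine measure_null_of_locally_null S fun t _ => ?_
    obtain ⟨U, hU, hle⟩ := exists_nhds_hausdorffMeasure_image_le (h t) (lt_add_one _)
    refine ⟨S ∩ U, inter_mem self_mem_nhdsWithin (mem_nhdsWithin_of_mem_nhds hU), ?_⟩
    rw [happ]
    refine le_antisymm ((hle _ inter_subset_right).trans ?_) bot_le
    rw [measure_mono_null inter_subset_left hS, mul_zero]
  rw [← Measure.withDensity_rnDeriv_eq μ volume hac]
  refine withDensity_congr_ae ?_
  filter_upwards [Besicovitch.ae_tendsto_rnDeriv μ volume] with t ht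
  have hball {U : Set ℝ} (hU : U ∈ 𝓝 t) :
      ∀ᶠ r in 𝓝[>] (0 : ℝ), closedBall t r ⊆ U ∧ volume (closedBall t r) ≠ 0 ∧
        volume (closedBall t r) ≠ ∞ := by
    obtain ⟨ε, hε, hεU⟩ := Metric.nhds_basis_closedBall.mem_iff.1 hU
    filter_upwards [Ioc_mem_nhdsGT hε] with r hr
    refine ⟨(closedBall_subset_closedBall hr.2).trans hεU, ?_, measure_closedBall_lt_top.ne⟩
    exact (measure_closedBall_pos _ _ hr.1).ne'
  apply le_antisymm
  · refine ENNReal.le_of_forall_pos_le_add fun ε hε _ => ?_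
    obtain ⟨U, hU, hle⟩ := exists_nhds_hausdorffMeasure_image_le (h t) (K := ‖γ' t‖₊ + ε)
      (lt_add_of_pos_right _ hε)
    refine le_of_tendsto ht ?_
    filter_upwards [hball hU] with r hr
    have := hle _ hr.1
    rw [← happ] at this
    rw [ENNReal.div_le_iff hr.2.1 hr.2.2]
    simpa [enorm] using this
  · refine ENNReal.le_of_forall_nnreal_lt fun k hk => ?_
    obtain ⟨U, hU, hle⟩ := exists_nhds_le_hausdorffMeasure_image hγ (h t) (k := k)
      (by simpa [enorm] using hk)
    refine ge_of_tendsto ht ?_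
    filter_upwards [hball hU] with r hr
    have := hle _ hr.1
    rw [← happ] at this
    rwa [ENNReal.le_div_iff_mul_le (Or.inl hr.2.1) (Or.inl hr.2.2)]

variable {E : Type*} [NormedAddCommGroup E] [NormedSpace ℝ E]

theorem integral_range_hausdorffMeasure {γ γ' : ℝ → F} (hγ : Function.Injective γ)
    (h : ∀ t, HasStrictDerivAt γ (γ' t) t) (hγ' : Continuous γ') (g : F → E) :
    ∫ x in range γ, g x ∂(Measure.hausdorffMeasure 1) = ∫ t, ‖γ' t‖ • g (γ t) := by
  have hcont : Continuous γ := continuous_iff_continuousAt.2 fun t => (h t).hasDerivAt.continuousAt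
  have hemb : MeasurableEmbedding γ := hcont.measurableEmbedding hγ
  rw [hausdorffMeasure_restrict_range hγ h, hemb.integral_map]
  exact integral_withDensity_eq_integral_smul (f := fun t => ‖γ' t‖₊) hγ'.nnnorm.measurable _

theorem integrableOn_range_hausdorffMeasure {γ γ' : ℝ → F} (hγ : Function.Injective γ)
    (h : ∀ t, HasStrictDerivAt γ (γ' t) t) (hγ' : Continuous γ') (g : F → E) :
    IntegrableOn g (range γ) (Measure.hausdorffMeasure 1) ↔
      Integrable fun t => ‖γ' t‖ • g (γ t) := by
  have hcont : Continuous γ := continuous_iff_continuousAt.2 fun t => (h t).hasDerivAt.continuousAt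
  have hemb : MeasurableEmbedding γ := hcont.measurableEmbedding hγ
  rw [IntegrableOn, hausdorffMeasure_restrict_range hγ h, hemb.integrable_map_iff]
  exact integrable_withDensity_iff_integrable_smul (f := fun t => ‖γ' t‖₊) hγ'.nnnorm.measurable

end curve

/-! ### The Funk-Radon transform as a Radon transform -/

/-- The arc with parameters `s`, `φ`, as the image under `chart` of the line `⟨y, e(φ)⟩ = s`. -/
def arc (φ s t : ℝ) : Plane := chart (framePoint φ s t)

theorem genFun_eq (x : Plane) (s φ : ℝ) : genFun x s φ = s - ⟪chartInv x, unitVec φ⟫ := by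
  rw [genFun, psi, chartInv, real_inner_smul_left]
  ring

theorem levelCurve_eq_range_arc (s φ : ℝ) : levelCurve disc genFun s φ = range (arc φ s) := by
  ext x
  simp only [levelCurve, genFun_eq, mem_ofPred_eq, mem_range, arc]
  constructor
  · rintro ⟨hx, h⟩
    refine ⟨⟪chartInv x, perpVec φ⟫, ?_⟩
    rw [sub_eq_zero.1 h, framePoint_inner, chart_chartInv hx]
  · rintro ⟨t, rfl⟩
    exact ⟨chart_mem_disc _, by rw [chartInv_chart, inner_framePoint_unitVec, sub_self]⟩

theorem arc_injective (φ s : ℝ) : Function.Injective (arc φ s) := by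
  intro t t' h
  rw [← inner_framePoint_perpVec φ s t, ← inner_framePoint_perpVec φ s t', chart_injective h]

theorem hasStrictDerivAt_arc (φ s t : ℝ) :
    HasStrictDerivAt (arc φ s) (chartDeriv (framePoint φ s t) (perpVec φ)) t := by
  have h : HasStrictDerivAt (framePoint φ s) (perpVec φ) t := by
    have h : HasStrictDerivAt (framePoint φ s) ((1 : ℝ) • perpVec φ) t :=
      ((hasStrictDerivAt_id t).smul_const (perpVec φ)).const_add (s • unitVec φ)
    rwa [one_smul] at h
  exact (hasStrictFDerivAt_chart _).comp_hasStrictDerivAt t h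

theorem continuous_framePoint_right (φ s : ℝ) : Continuous (framePoint φ s) := by
  unfold framePoint
  fun_prop

theorem continuous_deriv_arc (φ s : ℝ) :
    Continuous fun t => chartDeriv (framePoint φ s t) (perpVec φ) := by
  have hc := continuous_framePoint_right φ s
  have h1 := continuous_bracket.comp hc
  have h2 := continuous_chartJac.comp hc
  simp only [chartDeriv_apply]
  refine Continuous.sub (Continuous.smul (Continuous.inv₀ (continuous_const.add h1) fun t => ?_)
    continuous_const) (Continuous.smul (h2.mul (hc.inner continuous_const)) hc)
  have := bracket_pos (framePoint φ s t)
  exact (by positivity : 0 < 1 + bracket (framePoint φ s t)).ne'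

theorem gradient_genFun_chart (y : Plane) (s φ : ℝ) :
    gradient (fun x => genFun x s φ) (chart y) =
      -((1 + bracket y) • unitVec φ + ⟪y, unitVec φ⟫ • y) := by
  have hq := bracket_pos y
  have hx := one_sub_norm_chart_sq y
  set x := chart y with hxdef
  have hne : 1 - ‖x‖ ^ 2 ≠ 0 := by rw [hx]; positivity
  have h1 : HasFDerivAt (fun x : Plane => ⟪x, unitVec φ⟫) (innerSL ℝ (unitVec φ)) x := by
    have := (innerSL ℝ (unitVec φ)).hasFDerivAt (x := x)
    refine this.congr_of_eventuallyEq (Eventually.of_forall fun z => ?_)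
    simp [real_inner_comm]
  have h2 : HasFDerivAt (fun x : Plane => 1 - ‖x‖ ^ 2) (-(2 • innerSL ℝ x)) x :=
    (hasStrictFDerivAt_norm_sq x).hasFDerivAt.const_sub 1
  have h3 := (((h1.const_mul 2).neg).mul ((hasDerivAt_inv hne).comp_hasFDerivAt x h2)).const_add s
  have h4 : HasGradientAt (fun x => genFun x s φ)
      (-((1 + bracket y) • unitVec φ + ⟪y, unitVec φ⟫ • y)) x := by
    rw [hasGradientAt_iff_hasFDerivAt]
    convert! h3 using 1
    ext1 v
    have hy : y = (1 + bracket y) • x := by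
      rw [hxdef, chart, smul_smul, mul_inv_cancel₀ (by positivity), one_smul]
    simp [InnerProductSpace.toDual_apply_apply]
    rw [hx]
    have e1 : ⟪y, v⟫ = (1 + bracket y) * ⟪x, v⟫ := by
      conv_lhs => rw [hy]
      rw [real_inner_smul_left]
    have e2 : ⟪y, unitVec φ⟫ = (1 + bracket y) * ⟪x, unitVec φ⟫ := by
      conv_lhs => rw [hy]
      rw [real_inner_smul_left]
    rw [e1, e2]
    field_simp
  exact h4.gradient

/-- On the arc the cross terms of `gradient_genFun_chart` combine through `|y|² = q² - 1`, where
`q = √(1 + |y|²)`. -/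
theorem norm_gradient_genFun_arc (s φ t : ℝ) :
    ‖gradient (fun x => genFun x s φ) (arc φ s t)‖ =
      (1 + bracket (framePoint φ s t)) * √(1 + s ^ 2) := by
  rw [arc, gradient_genFun_chart, norm_neg, inner_framePoint_unitVec]
  have hq := bracket_pos (framePoint φ s t)
  have hq2 := bracket_sq (framePoint φ s t)
  set q := bracket (framePoint φ s t)
  rw [← sq_eq_sq₀ (norm_nonneg _) (by positivity), mul_pow, Real.sq_sqrt (by positivity),
    norm_add_sq_real, norm_smul, norm_smul, real_inner_smul_left, real_inner_smul_right,
    real_inner_comm, inner_framePoint_unitVec, norm_unitVec, mul_pow, mul_pow, Real.norm_eq_abs,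
    Real.norm_eq_abs, sq_abs, sq_abs]
  linear_combination (-s ^ 2) * hq2

theorem norm_deriv_arc (s φ t : ℝ) :
    ‖chartDeriv (framePoint φ s t) (perpVec φ)‖ =
      chartJac (framePoint φ s t) * ((1 + bracket (framePoint φ s t)) * √(1 + s ^ 2)) := by
  rw [chartDeriv_apply, inner_framePoint_perpVec]
  have hq := bracket_pos (framePoint φ s t)
  have hq2 := bracket_sq (framePoint φ s t)
  have hJ := chartJac_pos (framePoint φ s t)
  have hn := norm_framePoint_sq φ s t
  rw [← sq_eq_sq₀ (norm_nonneg _) (by positivity), mul_pow, mul_pow, Real.sq_sqrt (by positivity),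
    norm_sub_sq_real, norm_smul, norm_smul, real_inner_smul_left, real_inner_smul_right,
    real_inner_comm, inner_framePoint_perpVec, norm_perpVec, mul_pow, mul_pow, Real.norm_eq_abs,
    Real.norm_eq_abs, sq_abs, sq_abs, chartJac]
  rw [hn] at hq2 ⊢
  have hs : s ^ 2 = bracket (framePoint φ s t) ^ 2 - 1 - t ^ 2 := by linarith
  set q := bracket (framePoint φ s t)
  rw [hs]
  field_simp
  ring

variable {E : Type*} [NormedAddCommGroup E] [NormedSpace ℝ E]

/-- The coarea identity for the family of arcs: the speed of an arc divided by `|∇Φ|` is the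
Jacobian of `chart`. -/
theorem norm_deriv_arc_smul_frIntegrand (f : Plane → E) (s φ t : ℝ) :
    ‖chartDeriv (framePoint φ s t) (perpVec φ)‖ • frIntegrand genFun f s φ (arc φ s t) =
      pull f (framePoint φ s t) := by
  have hq := bracket_pos (framePoint φ s t)
  have hs : 0 < √(1 + s ^ 2) := Real.sqrt_pos.2 (by positivity)
  rw [frIntegrand, norm_gradient_genFun_arc, norm_deriv_arc, smul_smul, pull, arc]
  congr 1
  field_simp

/-- In the chart the Funk-Radon transform of `f` is the Radon transform of `pull f`. -/
theorem funkRadon_eq_integral_pull (f : Plane → E) (s φ : ℝ) :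
    funkRadon disc genFun f s φ = ∫ t, pull f (framePoint φ s t) := by
  rw [funkRadon, levelCurve_eq_range_arc, integral_range_hausdorffMeasure (arc_injective φ s)
    (hasStrictDerivAt_arc φ s) (continuous_deriv_arc φ s)]
  simp only [norm_deriv_arc_smul_frIntegrand]

theorem integrableOn_levelCurve_iff (f : Plane → E) (s φ : ℝ) :
    IntegrableOn (frIntegrand genFun f s φ) (levelCurve disc genFun s φ)
      (Measure.hausdorffMeasure 1) ↔ Integrable fun t => pull f (framePoint φ s t) := by
  rw [levelCurve_eq_range_arc, integrableOn_range_hausdorffMeasure (arc_injective φ s)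
    (hasStrictDerivAt_arc φ s) (continuous_deriv_arc φ s)]
  simp only [norm_deriv_arc_smul_frIntegrand]

theorem ae_integrableOn_levelCurve {f : Plane → E} (hf : Integrable (pull f)) (φ : ℝ) :
    ∀ᵐ s : ℝ, IntegrableOn (frIntegrand genFun f s φ) (levelCurve disc genFun s φ)
      (Measure.hausdorffMeasure 1) := by
  simp only [integrableOn_levelCurve_iff]
  exact ((measurePreserving_framePoint φ).integrable_comp_of_integrable hf).prod_right_ae

/-! ### The angular integral of the regularized kernel -/

theorem regInvSq_eq (ε t : ℝ) : regInvSq ε t = (t ^ 2 - ε ^ 2) / (t ^ 2 + ε ^ 2) ^ 2 := by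
  rw [regInvSq, Complex.inv_re]
  congr 1
  · simp [pow_two]
  · simp [pow_two, Complex.normSq_apply]
    ring

theorem abs_regInvSq_le {ε : ℝ} (hε : 0 < ε) (t : ℝ) : |regInvSq ε t| ≤ (ε ^ 2)⁻¹ := by
  rw [regInvSq_eq, abs_div, abs_of_pos (by positivity : 0 < (t ^ 2 + ε ^ 2) ^ 2),
    div_le_iff₀ (by positivity), inv_mul_eq_div, le_div_iff₀ (by positivity)]
  have h1 : |t ^ 2 - ε ^ 2| ≤ t ^ 2 + ε ^ 2 := by
    rw [abs_le]
    constructor <;> nlinarith [sq_nonneg t, sq_nonneg ε]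
  calc |t ^ 2 - ε ^ 2| * ε ^ 2 ≤ (t ^ 2 + ε ^ 2) * (t ^ 2 + ε ^ 2) := by
        gcongr
        nlinarith [sq_nonneg t]
    _ = (t ^ 2 + ε ^ 2) ^ 2 := by ring

theorem continuous_regInvSq {ε : ℝ} (hε : 0 < ε) : Continuous (regInvSq ε) := by
  have : regInvSq ε = fun t => (t ^ 2 - ε ^ 2) / (t ^ 2 + ε ^ 2) ^ 2 := funext (regInvSq_eq ε)
  rw [this]
  refine Continuous.div (by fun_prop) (by fun_prop) fun t => ?_
  positivity

/-- The mean over the circle of `Re (T + iε)⁻²`, for `T` the restriction of a linear form to the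
circle, is a multiple of the Poisson kernel of the half-space `ℝ² × (0, ∞)`. The integrand has an
antiderivative which is globally smooth and periodic up to a linear term. -/
theorem integral_regInvSq_cos_sin {ε : ℝ} (hε : 0 < ε) (A B : ℝ) :
    ∫ φ in (0 : ℝ)..(2 * Real.pi), regInvSq ε (A * Real.cos φ + B * Real.sin φ) =
      -(2 * Real.pi * ε) / √(A ^ 2 + B ^ 2 + ε ^ 2) ^ 3 := by
  set R := √(A ^ 2 + B ^ 2 + ε ^ 2) with hR
  have hR0 : 0 < R := Real.sqrt_pos.2 (by positivity)
  have hR2 : R ^ 2 = A ^ 2 + B ^ 2 + ε ^ 2 := Real.sq_sqrt (by positivity)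
  set T : ℝ → ℝ := fun φ => A * Real.cos φ + B * Real.sin φ with hT
  set U : ℝ → ℝ := fun φ => B * Real.cos φ - A * Real.sin φ with hU
  have hTU (φ : ℝ) : U φ ^ 2 = R ^ 2 - ε ^ 2 - T φ ^ 2 := by
    simp only [hT, hU, hR2]
    linear_combination (A ^ 2 + B ^ 2) * Real.sin_sq_add_cos_sq φ
  have hdT (φ : ℝ) : HasDerivAt T (U φ) φ := by
    have := ((Real.hasDerivAt_cos φ).const_mul A).add ((Real.hasDerivAt_sin φ).const_mul B)
    convert! this using 1
    simp only [hU]; ring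
  have hdU (φ : ℝ) : HasDerivAt U (-T φ) φ := by
    have := ((Real.hasDerivAt_cos φ).const_mul B).sub ((Real.hasDerivAt_sin φ).const_mul A)
    convert! this using 1
    simp only [hT]; ring
  have hder (φ : ℝ) : HasDerivAt
      (fun φ => -(ε / R ^ 3) * (φ + Real.arctan (T φ * U φ / (T φ ^ 2 + (ε ^ 2 + ε * R))))
        - T φ * U φ / (R ^ 2 * (T φ ^ 2 + ε ^ 2)))
      (regInvSq ε (T φ)) φ := by
    have hD : 0 < T φ ^ 2 + (ε ^ 2 + ε * R) := by positivity
    have hD2 : 0 < R ^ 2 * (T φ ^ 2 + ε ^ 2) := by positivity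
    have hN := (hdT φ).mul (hdU φ)
    have hS := (hdT φ).pow 2
    have h1 := (hN.div (hS.add_const (ε ^ 2 + ε * R)) hD.ne').arctan
    have h2 := hN.div ((hS.add_const (ε ^ 2)).const_mul (R ^ 2)) hD2.ne'
    have h3 := (((hasDerivAt_id φ).add h1).const_mul (-(ε / R ^ 3))).sub h2
    convert! h3 using 1
    rw [regInvSq_eq]
    have hu := hTU φ
    simp only [Pi.mul_apply, Pi.pow_apply, Pi.div_apply]
    generalize T φ = τ at *
    generalize U φ = υ at *
    -- the arctangent term alone differentiates to `ε R / (T² + ε²)`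
    have key : 1 + 1 / (1 + (τ * υ / (τ ^ 2 + (ε ^ 2 + ε * R))) ^ 2) *
        (((υ * υ + τ * -τ) * (τ ^ 2 + (ε ^ 2 + ε * R)) - τ * υ * (((2 : ℕ) : ℝ) * τ ^ (2 - 1) * υ)) /
          (τ ^ 2 + (ε ^ 2 + ε * R)) ^ 2) = ε * R / (τ ^ 2 + ε ^ 2) := by
      have hq : 1 + (τ * υ / (τ ^ 2 + (ε ^ 2 + ε * R))) ^ 2 =
          (τ ^ 2 + ε ^ 2) * (ε + R) ^ 2 / (τ ^ 2 + (ε ^ 2 + ε * R)) ^ 2 := by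
        rw [div_pow, mul_pow, hu]
        field_simp
        ring
      have hn : (υ * υ + τ * -τ) * (τ ^ 2 + (ε ^ 2 + ε * R))
          - τ * υ * (((2 : ℕ) : ℝ) * τ ^ (2 - 1) * υ) =
          (R + ε) ^ 2 * (ε * R - ε ^ 2 - τ ^ 2) := by
        norm_num
        linear_combination (ε ^ 2 + ε * R - τ ^ 2) * hu
      rw [hq, hn]
      field_simp
      ring
    rw [key]
    field_simp
    norm_num
    have e1 : υ * υ = R ^ 2 - ε ^ 2 - τ ^ 2 := by rw [← hu]; ring
    linear_combination (ε ^ 2 - τ ^ 2) * e1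
  have hint : IntervalIntegrable (fun φ => regInvSq ε (T φ)) volume 0 (2 * Real.pi) := by
    refine ((continuous_regInvSq hε).comp ?_).intervalIntegrable _ _
    simp only [hT]; fun_prop
  rw [intervalIntegral.integral_eq_sub_of_hasDerivAt (fun φ _ => hder φ) hint]
  simp only [hT, hU, Real.cos_two_pi, Real.sin_two_pi, Real.cos_zero, Real.sin_zero]
  ring

theorem inner_unitVec (w : Plane) (φ : ℝ) :
    ⟪w, unitVec φ⟫ = w 0 * Real.cos φ + w 1 * Real.sin φ := by
  simp [unitVec, PiLp.inner_apply, Fin.sum_univ_two]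
  ring

theorem integral_regInvSq_inner {ε : ℝ} (hε : 0 < ε) (a : ℝ) (w : Plane) :
    ∫ φ in (0 : ℝ)..(2 * Real.pi), regInvSq ε (a * ⟪w, unitVec φ⟫) =
      -(2 * Real.pi * ε) / √(a ^ 2 * ‖w‖ ^ 2 + ε ^ 2) ^ 3 := by
  have h3 : ‖w‖ ^ 2 = w 0 ^ 2 + w 1 ^ 2 := by
    simp [EuclideanSpace.norm_sq_eq, Fin.sum_univ_two]
  have h := integral_regInvSq_cos_sin hε (a * w 0) (a * w 1)
  simp only [inner_unitVec, h3, mul_add, ← mul_assoc]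
  rw [h, mul_pow, mul_pow]

/-! ### The regularized reconstruction as a Poisson integral -/

/-- The Poisson kernel of the half-space `ℝ² × (0, ∞)` at height `δ`. -/
def poissonKernel (δ : ℝ) (w : Plane) : ℝ := δ / (2 * Real.pi * √(‖w‖ ^ 2 + δ ^ 2) ^ 3)

theorem denom_eq {x : Plane} (hx : x ∈ disc) (s φ : ℝ) :
    denom x s φ = (1 - ‖x‖ ^ 2) * (s - ⟪chartInv x, unitVec φ⟫) := by
  have h := one_sub_norm_sq_pos hx
  rw [denom, chartInv, real_inner_smul_left]
  field_simp

section
variable {E : Type*} [NormedAddCommGroup E] [NormedSpace ℝ E]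

/-- The integrand of the regularized reconstruction, as a function of the angle `φ` and of the point
`y` on the line `⟨y, e(φ)⟩ = s`. -/
def backIntegrand (g : Plane → E) (ε : ℝ) (x : Plane) (φ : ℝ) (y : Plane) : E :=
  regInvSq ε (denom x ⟪y, unitVec φ⟫ φ) • g y

theorem backIntegrand_framePoint (g : Plane → E) (ε : ℝ) (x : Plane) (φ s t : ℝ) :
    backIntegrand g ε x φ (framePoint φ s t) =
      regInvSq ε (denom x s φ) • g (framePoint φ s t) := by
  rw [backIntegrand, inner_framePoint_unitVec]

theorem continuous_unitVec : Continuous unitVec := by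
  unfold unitVec; fun_prop

theorem integrable_backIntegrand {g : Plane → E} (hg : Integrable g) {ε : ℝ} (hε : 0 < ε)
    (x : Plane) (μ : Measure ℝ) [IsFiniteMeasure μ] :
    Integrable (Function.uncurry (backIntegrand g ε x)) (μ.prod volume) := by
  have hg2 : Integrable (fun p : ℝ × Plane => g p.2) (μ.prod volume) := hg.comp_snd μ
  have hc : Continuous fun p : ℝ × Plane => regInvSq ε (denom x ⟪p.2, unitVec p.1⟫ p.1) := by
    have := continuous_unitVec
    refine (continuous_regInvSq hε).comp ?_
    unfold denom
    fun_prop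
  exact hg2.bdd_smul (ε ^ 2)⁻¹ hc.aestronglyMeasurable
    (Eventually.of_forall fun p => abs_regInvSq_le hε _)

theorem integrable_backIntegrand_right {g : Plane → E} (hg : Integrable g) {ε : ℝ} (hε : 0 < ε)
    (x : Plane) (φ : ℝ) : Integrable (backIntegrand g ε x φ) := by
  have hc : Continuous fun y : Plane => regInvSq ε (denom x ⟪y, unitVec φ⟫ φ) := by
    refine (continuous_regInvSq hε).comp ?_
    unfold denom
    fun_prop
  exact hg.bdd_smul (ε ^ 2)⁻¹ hc.aestronglyMeasurable
    (Eventually.of_forall fun p => abs_regInvSq_le hε _)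

theorem integrable_regInvSq_smul_funkRadon {f : Plane → E} (hf : Integrable (pull f)) {ε : ℝ}
    (hε : 0 < ε) (x : Plane) (μ : Measure ℝ) [IsFiniteMeasure μ] :
    Integrable (fun p : ℝ × ℝ => regInvSq ε (denom x p.1 p.2) • funkRadon disc genFun f p.1 p.2)
      ((volume : Measure ℝ).prod μ) := by
  have hmp : MeasurePreserving (fun p : ℝ × (ℝ × ℝ) => (p.1, framePoint p.1 p.2.1 p.2.2))
      (μ.prod (volume.prod volume)) (μ.prod volume) :=
    (MeasurePreserving.id μ).skew_product continuous_framePoint.measurable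
      (Eventually.of_forall fun φ => (measurePreserving_framePoint φ).map_eq)
  have h1 := (measurePreserving_prodAssoc μ (volume : Measure ℝ)
    (volume : Measure ℝ)).integrable_comp_of_integrable
      (hmp.integrable_comp_of_integrable (integrable_backIntegrand hf hε x μ))
  have h2 := h1.integral_prod_left.swap
  refine h2.congr (Eventually.of_forall fun p => ?_)
  simp only [Function.comp, Prod.swap, Function.uncurry, MeasurableEquiv.prodAssoc,
    MeasurableEquiv.coe_mk, Equiv.prodAssoc_apply, backIntegrand_framePoint, integral_smul,
    funkRadon_eq_integral_pull]

theorem integral_regInvSq_smul_funkRadon {f : Plane → E} (hf : Integrable (pull f)) {ε : ℝ}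
    (hε : 0 < ε) (x : Plane) (φ : ℝ) :
    ∫ s, regInvSq ε (denom x s φ) • funkRadon disc genFun f s φ =
      ∫ y, backIntegrand (pull f) ε x φ y := by
  have hB := integrable_backIntegrand_right hf hε x φ
  have hmp := measurePreserving_framePoint φ
  have h2 := hmp.integrable_comp_of_integrable hB
  rw [← hmp.map_eq] at hB
  rw [← hmp.map_eq, integral_map hmp.measurable.aemeasurable hB.aestronglyMeasurable]
  rw [Measure.volume_eq_prod] at h2 ⊢
  simp only [Function.comp_def] at h2
  rw [integral_prod _ h2]
  simp only [backIntegrand_framePoint, integral_smul, funkRadon_eq_integral_pull]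

theorem reconstruction_eq_poisson [CompleteSpace E] {f : Plane → E} (hf : Integrable (pull f)) {ε : ℝ}
    (hε : 0 < ε) {x : Plane} (hx : x ∈ disc) :
    reconstruction f ε x = (chartJac (chartInv x))⁻¹ •
      ∫ y, poissonKernel (ε / (1 - ‖x‖ ^ 2)) (chartInv x - y) • pull f y := by
  have ha := one_sub_norm_sq_pos hx
  have hpi := Real.pi_pos
  have hpv : pvApprox denom (funkRadon disc genFun f) ε x =
      ∫ y, (-(2 * Real.pi * ε) /
        √((1 - ‖x‖ ^ 2) ^ 2 * ‖y - chartInv x‖ ^ 2 + ε ^ 2) ^ 3) • pull f y := by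
    simp only [pvApprox, integral_regInvSq_smul_funkRadon hf hε]
    rw [intervalIntegral.integral_of_le (by positivity),
      integral_integral_swap (integrable_backIntegrand hf hε x _)]
    congr 1 with y
    rw [← integral_regInvSq_inner hε, intervalIntegral.integral_of_le (by positivity),
      ← integral_smul_const]
    simp only [backIntegrand, denom_eq hx, inner_sub_left]
  rw [reconstruction, hpv, ← integral_smul, ← integral_smul]
  congr 1 with y
  rw [smul_smul, smul_smul, chartJac_chartInv hx, poissonKernel, norm_sub_rev]
  congr 1
  have hs : √((1 - ‖x‖ ^ 2) ^ 2 * ‖chartInv x - y‖ ^ 2 + ε ^ 2) =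
      (1 - ‖x‖ ^ 2) * √(‖chartInv x - y‖ ^ 2 + (ε / (1 - ‖x‖ ^ 2)) ^ 2) := by
    rw [← Real.sqrt_sq ha.le, ← Real.sqrt_mul (by positivity), Real.sqrt_sq ha.le]
    congr 1
    field_simp
  have hs0 : 0 < √(‖chartInv x - y‖ ^ 2 + (ε / (1 - ‖x‖ ^ 2)) ^ 2) :=
    Real.sqrt_pos.2 (by positivity)
  rw [hs]
  generalize √(‖chartInv x - y‖ ^ 2 + (ε / (1 - ‖x‖ ^ 2)) ^ 2) = r at *
  field_simp
  ring

end

/-! ### Convergence of Poisson integrals -/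

section
open scoped ENNReal

theorem poissonKernel_nonneg {δ : ℝ} (hδ : 0 ≤ δ) (w : Plane) : 0 ≤ poissonKernel δ w := by
  have := Real.pi_pos
  unfold poissonKernel; positivity

theorem sqrt_norm_sq_add_pos {δ : ℝ} (hδ : 0 < δ) (w : Plane) : 0 < √(‖w‖ ^ 2 + δ ^ 2) :=
  Real.sqrt_pos.2 (by positivity)

theorem continuous_poissonKernel {δ : ℝ} (hδ : 0 < δ) : Continuous (poissonKernel δ) := by
  unfold poissonKernel
  refine Continuous.div (by fun_prop) (by fun_prop) fun w => ?_
  have := sqrt_norm_sq_add_pos hδ w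
  have := Real.pi_pos
  positivity

theorem poissonKernel_le {δ : ℝ} (hδ : 0 < δ) (w : Plane) :
    poissonKernel δ w ≤ δ / (2 * Real.pi * δ ^ 3) := by
  have hpi := Real.pi_pos
  have h : δ ≤ √(‖w‖ ^ 2 + δ ^ 2) := Real.le_sqrt_of_sq_le (by nlinarith [sq_nonneg ‖w‖])
  unfold poissonKernel
  gcongr

theorem poissonKernel_eq_scale {δ : ℝ} (hδ : 0 < δ) (w : Plane) :
    poissonKernel δ w = δ⁻¹ ^ 2 * poissonKernel 1 (δ⁻¹ • w) := by
  have hpi := Real.pi_pos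
  have h0 := sqrt_norm_sq_add_pos hδ w
  have h : √(‖δ⁻¹ • w‖ ^ 2 + 1 ^ 2) = δ⁻¹ * √(‖w‖ ^ 2 + δ ^ 2) := by
    rw [← Real.sqrt_sq (inv_pos.2 hδ).le, ← Real.sqrt_mul (by positivity),
      Real.sqrt_sq (inv_pos.2 hδ).le, norm_smul, Real.norm_eq_abs, abs_of_pos (inv_pos.2 hδ)]
    congr 1
    field_simp
  rw [poissonKernel, poissonKernel, h]
  field_simp

theorem poissonKernel_mul_le {δ c C : ℝ} (hδ : 0 < δ) (hc : 1 ≤ c) (hC : c ≤ C) (w : Plane) :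
    poissonKernel (c * δ) w ≤ C * poissonKernel δ w := by
  have hpi := Real.pi_pos
  have h0 := sqrt_norm_sq_add_pos hδ w
  have h : √(‖w‖ ^ 2 + δ ^ 2) ≤ √(‖w‖ ^ 2 + (c * δ) ^ 2) := by
    gcongr
    nlinarith
  have hC0 : 0 ≤ C := by linarith
  unfold poissonKernel
  rw [← mul_div_assoc]
  gcongr

theorem integral_poissonKernel_one : ∫ w, poissonKernel 1 w = 1 := by
  have hpi := Real.pi_pos
  have hr (r : ℝ) : 0 < r ^ 2 + 1 := by positivity
  have hder (r : ℝ) : HasDerivAt (fun r => -(2 * Real.pi * √(r ^ 2 + 1))⁻¹)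
      (r * (1 / (2 * Real.pi * √(r ^ 2 + 1) ^ 3))) r := by
    have h0 : 0 < √(r ^ 2 + 1) := Real.sqrt_pos.2 (hr r)
    have h1 := ((((hasDerivAt_pow 2 r).add_const 1).sqrt (hr r).ne').const_mul
      (2 * Real.pi)).inv (by positivity)
    convert! h1.neg using 1
    simp
    field_simp
  have hlim : Tendsto (fun r : ℝ => -(2 * Real.pi * √(r ^ 2 + 1))⁻¹) atTop (𝓝 (-0)) := by
    refine (Tendsto.inv_tendsto_atTop ?_).neg
    refine Tendsto.const_mul_atTop (by positivity) (Real.tendsto_sqrt_atTop.comp ?_)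
    exact tendsto_atTop_add_const_right _ _ (tendsto_pow_atTop two_ne_zero)
  have hint := integral_Ioi_of_hasDerivAt_of_nonneg' (a := 0) (fun r _ => hder r)
    (fun r hr0 => by have : 0 < r := hr0; positivity) hlim
  have h := integral_fun_norm_addHaar (volume : Measure Plane)
    (fun r => 1 / (2 * Real.pi * √(r ^ 2 + 1 ^ 2) ^ 3))
  have hvol : (volume : Measure Plane).real (ball 0 1) = Real.pi := by
    simp [Measure.real, EuclideanSpace.volume_ball_fin_two, hpi.le]
  rw [hvol] at h
  simp only [finrank_euclideanSpace_fin, pow_one, smul_eq_mul, nsmul_eq_mul, one_pow,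
    Nat.add_one_sub_one] at h hint
  simp only [poissonKernel, one_pow]
  rw [h, hint]
  simp

theorem lintegral_poissonKernel {δ : ℝ} (hδ : 0 < δ) :
    ∫⁻ w, ENNReal.ofReal (poissonKernel δ w) = 1 := by
  have h1 : ∫ w, poissonKernel δ w = 1 := by
    simp only [poissonKernel_eq_scale hδ]
    rw [integral_const_mul, Measure.integral_comp_smul, integral_poissonKernel_one,
      finrank_euclideanSpace_fin, abs_of_pos (by positivity)]
    simp
    field_simp
  rw [← ofReal_integral_eq_lintegral_ofReal (integrable_of_integral_eq_one h1)
    (Eventually.of_forall (poissonKernel_nonneg hδ.le)), h1, ENNReal.ofReal_one]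

theorem tendsto_norm_sq_mul_poissonKernel :
    Tendsto (fun w : Plane => ‖w‖ ^ 2 * poissonKernel 1 w) (Bornology.cobounded Plane) (𝓝 0) := by
  have hpi := Real.pi_pos
  have hlim : Tendsto (fun w : Plane => (2 * Real.pi * ‖w‖)⁻¹) (Bornology.cobounded Plane) (𝓝 0) :=
    Tendsto.inv_tendsto_atTop (tendsto_norm_cobounded_atTop.const_mul_atTop (by positivity))
  refine squeeze_zero' (Eventually.of_forall fun w => ?_) ?_ hlim
  · exact mul_nonneg (by positivity) (poissonKernel_nonneg zero_le_one w)
  · filter_upwards [tendsto_norm_cobounded_atTop.eventually_gt_atTop 0] with w hw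
    have h : ‖w‖ ≤ √(‖w‖ ^ 2 + 1 ^ 2) := Real.le_sqrt_of_sq_le (by nlinarith)
    calc ‖w‖ ^ 2 * poissonKernel 1 w ≤ ‖w‖ ^ 2 * (1 / (2 * Real.pi * ‖w‖ ^ 3)) := by
          unfold poissonKernel
          gcongr
      _ = (2 * Real.pi * ‖w‖)⁻¹ := by field_simp

variable {E : Type*} [NormedAddCommGroup E] [NormedSpace ℝ E]

/-- The Poisson integral of `g` at the point `(y, δ)` of the half-space. -/
def poissonIntegral (g : Plane → E) (δ : ℝ) (y : Plane) : E :=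
  ∫ z, poissonKernel δ (y - z) • g z

theorem tendsto_poissonIntegral [CompleteSpace E] {g : Plane → E} (hg : Integrable g) {y : Plane}
    (hy : ContinuousAt g y) :
    Tendsto (fun δ => poissonIntegral g δ y) (𝓝[>] 0) (𝓝 (g y)) := by
  have h := tendsto_integral_comp_smul_smul_of_integrable' (μ := volume)
    (poissonKernel_nonneg zero_le_one) integral_poissonKernel_one
    (by simpa using tendsto_norm_sq_mul_poissonKernel) hg hy
  refine (h.comp tendsto_inv_nhdsGT_zero).congr' ?_
  filter_upwards [self_mem_nhdsWithin] with δ hδ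
  simp only [Function.comp, poissonIntegral, poissonKernel_eq_scale hδ, finrank_euclideanSpace_fin]

theorem integrable_poissonKernel_smul {g : Plane → E} (hg : Integrable g) {δ : ℝ} (hδ : 0 < δ)
    (y : Plane) : Integrable fun z => poissonKernel δ (y - z) • g z := by
  refine hg.bdd_smul (δ / (2 * Real.pi * δ ^ 3))
    ((continuous_poissonKernel hδ).comp (continuous_sub_left y)).aestronglyMeasurable
    (Eventually.of_forall fun z => ?_)
  rw [Real.norm_of_nonneg (poissonKernel_nonneg hδ.le _)]
  exact poissonKernel_le hδ _

theorem poissonIntegral_sub {g h : Plane → E} (hg : Integrable g) (hh : Integrable h) {δ : ℝ}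
    (hδ : 0 < δ) (y : Plane) :
    poissonIntegral (g - h) δ y = poissonIntegral g δ y - poissonIntegral h δ y := by
  simp only [poissonIntegral, Pi.sub_apply, smul_sub]
  exact integral_sub (integrable_poissonKernel_smul hg hδ y) (integrable_poissonKernel_smul hh hδ y)

theorem lintegral_poissonKernel_sub_left {δ : ℝ} (hδ : 0 < δ) (y : Plane) :
    ∫⁻ z, ENNReal.ofReal (poissonKernel δ (y - z)) = 1 := by
  rw [lintegral_sub_left_eq_self (fun w => ENNReal.ofReal (poissonKernel δ w)) y,
    lintegral_poissonKernel hδ]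

theorem enorm_poissonIntegral_le (g : Plane → E) {δ : ℝ} (hδ : 0 < δ) (y : Plane) :
    ‖poissonIntegral g δ y‖ₑ ≤ ∫⁻ z, ENNReal.ofReal (poissonKernel δ (y - z)) * ‖g z‖ₑ := by
  refine (enorm_integral_le_lintegral_enorm _).trans_eq ?_
  refine lintegral_congr fun z => ?_
  rw [enorm_smul, Real.enorm_of_nonneg (poissonKernel_nonneg hδ.le _)]

theorem norm_poissonIntegral_le {g : Plane → E} {M : ℝ} (hM : ∀ z, ‖g z‖ ≤ M) {δ : ℝ}
    (hδ : 0 < δ) (y : Plane) : ‖poissonIntegral g δ y‖ ≤ M := by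
  have hM0 : 0 ≤ M := (norm_nonneg _).trans (hM 0)
  have h : ‖poissonIntegral g δ y‖ₑ ≤ ENNReal.ofReal M := by
    refine (enorm_poissonIntegral_le g hδ y).trans ?_
    calc ∫⁻ z, ENNReal.ofReal (poissonKernel δ (y - z)) * ‖g z‖ₑ
        ≤ ∫⁻ z, ENNReal.ofReal (poissonKernel δ (y - z)) * ENNReal.ofReal M := by
          refine lintegral_mono fun z => ?_
          rw [← ofReal_norm]
          gcongr
          exact hM z
      _ = ENNReal.ofReal M := by
        rw [lintegral_mul_const' _ _ ENNReal.ofReal_ne_top, lintegral_poissonKernel_sub_left hδ,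
          one_mul]
  rw [← ofReal_norm] at h
  exact (ENNReal.ofReal_le_ofReal_iff hM0).1 h

/-- Jensen's inequality for the square and a probability density `p`. -/
theorem sq_lintegral_mul_le {α : Type*} [MeasurableSpace α] {μ : Measure α} {p h : α → ℝ≥0∞}
    (hp : Measurable p) (hp1 : ∫⁻ z, p z ∂μ = 1) (hh : AEMeasurable h μ) :
    (∫⁻ z, p z * h z ∂μ) ^ 2 ≤ ∫⁻ z, p z * h z ^ 2 ∂μ := by
  have h1 : ∫⁻ z, h z ∂(μ.withDensity p) = ∫⁻ z, p z * h z ∂μ :=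
    lintegral_withDensity_eq_lintegral_mul₀ hp.aemeasurable hh
  have h2 : ∫⁻ z, h z ^ 2 ∂(μ.withDensity p) = ∫⁻ z, p z * h z ^ 2 ∂μ :=
    lintegral_withDensity_eq_lintegral_mul₀ hp.aemeasurable (hh.pow_const 2)
  have hmass : (μ.withDensity p) univ = 1 := by simpa using hp1
  have hh' : AEMeasurable h (μ.withDensity p) := hh.mono_ac (withDensity_absolutelyContinuous _ _)
  have h3 := ENNReal.lintegral_mul_le_Lp_mul_Lq (μ.withDensity p) Real.HolderConjugate.two_two hh'
    (aemeasurable_const (b := (1 : ℝ≥0∞)))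
  simp only [Pi.mul_apply, mul_one, ENNReal.one_rpow, lintegral_const, hmass] at h3
  rw [← h1, ← h2]
  calc (∫⁻ z, h z ∂(μ.withDensity p)) ^ 2
      ≤ ((∫⁻ z, h z ^ (2 : ℝ) ∂(μ.withDensity p)) ^ (1 / (2 : ℝ))) ^ 2 := by gcongr
    _ = ∫⁻ z, h z ^ 2 ∂(μ.withDensity p) := by
      rw [← ENNReal.rpow_natCast, ← ENNReal.rpow_mul]
      norm_num

theorem eLpNorm_two_sq {α F : Type*} [MeasurableSpace α] {μ : Measure α} [NormedAddCommGroup F]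
    (h : α → F) :
    eLpNorm h 2 μ ^ 2 = ∫⁻ z, ‖h z‖ₑ ^ 2 ∂μ := by
  have := eLpNorm_nnreal_pow_eq_lintegral (μ := μ) (f := h) (p := 2) two_ne_zero
  simpa using this

/-- Poisson integrals whose height varies by a bounded factor are bounded in `L²`. -/
theorem eLpNorm_poissonIntegral_le {g : Plane → E} (hg : AEStronglyMeasurable g) {c : Plane → ℝ}
    {C : ℝ} {S : Set Plane} (hS : MeasurableSet S) (hc1 : ∀ y, 1 ≤ c y) (hcC : ∀ y ∈ S, c y ≤ C)
    {δ : ℝ} (hδ : 0 < δ) :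
    eLpNorm (fun y => poissonIntegral g (c y * δ) y) 2 (volume.restrict S) ≤
      ENNReal.ofReal C * eLpNorm g 2 := by
  refine (ENNReal.pow_le_pow_left_iff two_ne_zero).1 ?_
  rw [mul_pow, eLpNorm_two_sq, eLpNorm_two_sq]
  have hk : Continuous fun p : Plane × Plane => ENNReal.ofReal (poissonKernel δ (p.1 - p.2)) :=
    ENNReal.continuous_ofReal.comp ((continuous_poissonKernel hδ).comp continuous_sub)
  calc ∫⁻ y in S, ‖poissonIntegral g (c y * δ) y‖ₑ ^ 2
      ≤ ∫⁻ y in S, ENNReal.ofReal C ^ 2 *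
          ∫⁻ z, ENNReal.ofReal (poissonKernel δ (y - z)) * ‖g z‖ₑ ^ 2 := by
        refine setLIntegral_mono' hS fun y hy => ?_
        have hcy : 0 < c y := one_pos.trans_le (hc1 y)
        have h1 : ‖poissonIntegral g (c y * δ) y‖ₑ ≤
            ENNReal.ofReal C * ∫⁻ z, ENNReal.ofReal (poissonKernel δ (y - z)) * ‖g z‖ₑ := by
          refine (enorm_poissonIntegral_le g (mul_pos hcy hδ) y).trans ?_
          rw [← lintegral_const_mul' _ _ ENNReal.ofReal_ne_top]
          refine lintegral_mono fun z => ?_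
          rw [← mul_assoc, ← ENNReal.ofReal_mul (hcy.le.trans (hcC y hy))]
          gcongr
          exact poissonKernel_mul_le hδ (hc1 y) (hcC y hy) _
        calc ‖poissonIntegral g (c y * δ) y‖ₑ ^ 2
            ≤ (ENNReal.ofReal C *
                ∫⁻ z, ENNReal.ofReal (poissonKernel δ (y - z)) * ‖g z‖ₑ) ^ 2 := by gcongr
          _ ≤ _ := by
            rw [mul_pow]
            gcongr
            exact sq_lintegral_mul_le (hk.comp (Continuous.prodMk_right y)).measurable
              (lintegral_poissonKernel_sub_left hδ y) hg.enorm
    _ ≤ ∫⁻ y, ENNReal.ofReal C ^ 2 *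
          ∫⁻ z, ENNReal.ofReal (poissonKernel δ (y - z)) * ‖g z‖ₑ ^ 2 :=
        setLIntegral_le_lintegral _ _
    _ = ENNReal.ofReal C ^ 2 * ∫⁻ z, ‖g z‖ₑ ^ 2 := by
        rw [lintegral_const_mul' _ _ (by finiteness), lintegral_lintegral_swap]
        · congr 1
          refine lintegral_congr fun z => ?_
          rw [lintegral_mul_const' _ _ (by finiteness),
            lintegral_sub_right_eq_self (fun w => ENNReal.ofReal (poissonKernel δ w)) z,
            lintegral_poissonKernel hδ, one_mul]
        · exact hk.measurable.aemeasurable.mul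
            ((hg.comp_snd (μ := (volume : Measure Plane))).enorm.pow_const 2)

theorem aestronglyMeasurable_poissonIntegral {g : Plane → E} (hg : AEStronglyMeasurable g)
    {c : Plane → ℝ} (hc : Continuous c) (hc1 : ∀ y, 1 ≤ c y) {δ : ℝ} (hδ : 0 < δ)
    (S : Set Plane) :
    AEStronglyMeasurable (fun y => poissonIntegral g (c y * δ) y) (volume.restrict S) := by
  have hk : Continuous fun p : Plane × Plane => poissonKernel (c p.1 * δ) (p.1 - p.2) := by
    unfold poissonKernel
    refine Continuous.div (by fun_prop) (by fun_prop) fun p => ?_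
    have := sqrt_norm_sq_add_pos (mul_pos (one_pos.trans_le (hc1 p.1)) hδ) (p.1 - p.2)
    have := Real.pi_pos
    positivity
  exact (hk.aestronglyMeasurable.smul
    (hg.comp_snd (μ := (volume.restrict S : Measure Plane)))).integral_prod_right'

theorem tendsto_mul_nhdsGT_zero {c : ℝ} (hc : 0 < c) :
    Tendsto (fun δ : ℝ => c * δ) (𝓝[>] 0) (𝓝[>] 0) := by
  refine tendsto_nhdsWithin_of_tendsto_nhds_of_eventually_within _ ?_ ?_
  · have : Tendsto (fun δ : ℝ => c * δ) (𝓝 0) (𝓝 (c * 0)) := (continuous_const_mul c).tendsto 0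
    rw [mul_zero] at this
    exact this.mono_left nhdsWithin_le_nhds
  · filter_upwards [self_mem_nhdsWithin] with δ hδ using mul_pos hc hδ

theorem tendsto_zero_of_sq_tendsto_zero {α : Type*} {l : Filter α} {u : α → ℝ≥0∞}
    (h : Tendsto (fun a => u a ^ 2) l (𝓝 0)) : Tendsto u l (𝓝 0) := by
  have hroot (x : ℝ≥0∞) : (x ^ 2) ^ (1 / 2 : ℝ) = x := by
    rw [← ENNReal.rpow_natCast, ← ENNReal.rpow_mul]
    norm_num
  have h2 := h.ennrpow_const (1 / 2)
  rw [ENNReal.zero_rpow_of_pos (by norm_num)] at h2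
  exact h2.congr fun a => hroot _

/-- For continuous `g` of compact support the Poisson integrals converge pointwise and are bounded by
the maximum of `|g|`, so dominated convergence applies on sets of finite measure. -/
theorem tendsto_eLpNorm_poissonIntegral_sub_of_continuous [CompleteSpace E] {g : Plane → E}
    (hg : Continuous g) (hgs : HasCompactSupport g) {c : Plane → ℝ} (hc : Continuous c)
    (hc1 : ∀ y, 1 ≤ c y) {S : Set Plane} (hSf : volume S ≠ ∞) :
    Tendsto (fun δ : ℝ => eLpNorm (fun y => poissonIntegral g (c y * δ) y - g y) 2
      (volume.restrict S)) (𝓝[>] 0) (𝓝 0) := by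
  obtain ⟨M, hM⟩ := hgs.exists_bound_of_continuous hg
  have hgi : Integrable g := hg.integrable_of_hasCompactSupport hgs
  have hsq : Tendsto (fun δ : ℝ => ∫⁻ y in S, ‖poissonIntegral g (c y * δ) y - g y‖ₑ ^ 2)
      (𝓝[>] 0) (𝓝 (∫⁻ y in S, 0)) := by
    refine tendsto_lintegral_filter_of_dominated_convergence' (fun _ => ENNReal.ofReal (M + M) ^ 2)
      ?_ ?_ ?_ ?_
    · filter_upwards [self_mem_nhdsWithin] with δ hδ
      exact ((aestronglyMeasurable_poissonIntegral hg.aestronglyMeasurable hc hc1 hδ S).sub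
        hg.aestronglyMeasurable).enorm.pow_const 2
    · filter_upwards [self_mem_nhdsWithin] with δ hδ
      refine Eventually.of_forall fun y => ?_
      rw [← ofReal_norm]
      gcongr
      exact (norm_sub_le _ _).trans (add_le_add
        (norm_poissonIntegral_le hM (mul_pos (one_pos.trans_le (hc1 y)) hδ) y) (hM y))
    · rw [lintegral_const, Measure.restrict_apply_univ]
      finiteness
    · refine Eventually.of_forall fun y => ?_
      have h1 := ((tendsto_poissonIntegral hgi (y := y) hg.continuousAt).comp
        (tendsto_mul_nhdsGT_zero (one_pos.trans_le (hc1 y)))).sub_const (g y)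
      have h2 := ENNReal.Tendsto.pow (n := 2) h1.enorm
      simpa [Function.comp_def] using h2
  rw [lintegral_zero] at hsq
  simp only [← eLpNorm_two_sq] at hsq
  exact tendsto_zero_of_sq_tendsto_zero hsq

/-- Poisson integrals of `g` at heights `c(y) δ` tend to `g` in `L²` on sets of finite measure on
which `c` is bounded. -/
theorem tendsto_eLpNorm_poissonIntegral_sub [CompleteSpace E] {g : Plane → E}
    (hg1 : Integrable g) (hg2 : MemLp g 2) {c : Plane → ℝ} (hc : Continuous c)
    (hc1 : ∀ y, 1 ≤ c y) {C : ℝ} {S : Set Plane} (hS : MeasurableSet S) (hcC : ∀ y ∈ S, c y ≤ C)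
    (hSf : volume S ≠ ∞) :
    Tendsto (fun δ : ℝ => eLpNorm (fun y => poissonIntegral g (c y * δ) y - g y) 2
      (volume.restrict S)) (𝓝[>] 0) (𝓝 0) := by
  rw [ENNReal.tendsto_nhds_zero]
  intro η hη
  rcases eq_or_ne η ∞ with rfl | hηt
  · exact Eventually.of_forall fun _ => le_top
  -- `κ` makes the two errors caused by replacing `g` by a continuous function add up to `η / 2`
  set κ : ℝ≥0∞ := η / 2 / (ENNReal.ofReal C + 1) with hκ
  have hκ0 : κ ≠ 0 := by
    rw [hκ]
    exact (ENNReal.div_pos (ENNReal.div_pos hη.ne' (by finiteness)).ne' (by finiteness)).ne'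
  obtain ⟨h, hhs, hgh, hhc, -⟩ := hg2.exists_hasCompactSupport_eLpNorm_sub_le (by finiteness) hκ0
  have hhi : Integrable h := hhc.integrable_of_hasCompactSupport hhs
  have hlim := tendsto_eLpNorm_poissonIntegral_sub_of_continuous hhc hhs hc hc1 hSf
  have hη2 : 0 < η / 2 := ENNReal.div_pos hη.ne' (by finiteness)
  filter_upwards [(ENNReal.tendsto_nhds_zero.1 hlim) _ hη2, self_mem_nhdsWithin] with δ h1 hδ
  have hδ' : 0 < δ := hδ
  have hdiff : AEStronglyMeasurable (g - h) :=
    hg1.aestronglyMeasurable.sub hhc.aestronglyMeasurable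
  have hm1 := aestronglyMeasurable_poissonIntegral hdiff hc hc1 hδ' S
  have hm2 := (aestronglyMeasurable_poissonIntegral hhc.aestronglyMeasurable hc hc1 hδ' S).sub
    (hhc.aestronglyMeasurable (μ := volume.restrict S))
  have heq : (fun y => poissonIntegral g (c y * δ) y - g y) =
      ((fun y => poissonIntegral (g - h) (c y * δ) y) +
        fun y => poissonIntegral h (c y * δ) y - h y) - (g - h) := by
    ext y
    simp only [Pi.sub_apply, Pi.add_apply]
    rw [poissonIntegral_sub hg1 hhi (mul_pos (one_pos.trans_le (hc1 y)) hδ')]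
    abel
  rw [heq]
  calc _ ≤ eLpNorm (fun y => poissonIntegral (g - h) (c y * δ) y) 2 (volume.restrict S) +
        eLpNorm (fun y => poissonIntegral h (c y * δ) y - h y) 2 (volume.restrict S) +
        eLpNorm (g - h) 2 (volume.restrict S) := by
        refine (eLpNorm_sub_le (hm1.add hm2) hdiff.restrict one_le_two).trans ?_
        gcongr
        exact eLpNorm_add_le hm1 hm2 one_le_two
    _ ≤ ENNReal.ofReal C * κ + η / 2 + κ := by
        gcongr
        · refine (eLpNorm_poissonIntegral_le hdiff hS hc1 hcC hδ').trans ?_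
          gcongr
        · exact (eLpNorm_mono_measure _ Measure.restrict_le_self).trans hgh
    _ = κ * (ENNReal.ofReal C + 1) + η / 2 := by ring
    _ = η := by
        rw [hκ, ENNReal.div_mul_cancel (by positivity) (by finiteness), ENNReal.add_halves]

end

/-! ### The reconstruction formula -/

section
open scoped ENNReal
variable {E : Type*} [NormedAddCommGroup E] [NormedSpace ℝ E]

theorem reconstruction_eq_poissonIntegral [CompleteSpace E] {f : Plane → E}
    (hf : Integrable (pull f)) {ε : ℝ} (hε : 0 < ε) {x : Plane} (hx : x ∈ disc) :
    reconstruction f ε x = (chartJac (chartInv x))⁻¹ •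
      poissonIntegral (pull f) (ε / (1 - ‖x‖ ^ 2)) (chartInv x) :=
  reconstruction_eq_poisson hf hε hx

theorem inv_chartJac_smul_pull {f : Plane → E} {x : Plane} (hx : x ∈ disc) :
    (chartJac (chartInv x))⁻¹ • pull f (chartInv x) = f x := by
  rw [pull, smul_smul, inv_mul_cancel₀ (chartJac_pos _).ne', one_smul, chart_chartInv hx]

/-- The reconstruction error in the chart. The height of the Poisson integral is the factor
`(1 + √(1 + |y|²)) / 2 = 1 / (1 - |x|²)` times `ε`. -/
theorem reconstruction_sub_chart [CompleteSpace E] {f : Plane → E} (hf : Integrable (pull f))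
    {ε : ℝ} (hε : 0 < ε) (y : Plane) :
    reconstruction f ε (chart y) - f (chart y) = (chartJac y)⁻¹ •
      (poissonIntegral (pull f) ((1 + bracket y) / 2 * ε) y - pull f y) := by
  have hq := bracket_pos y
  have hx := chart_mem_disc y
  rw [smul_sub, reconstruction_eq_poissonIntegral hf hε hx, ← inv_chartJac_smul_pull (f := f) hx,
    chartInv_chart, one_sub_norm_chart_sq]
  congr 4
  field_simp

theorem continuousAt_pull {f : Plane → E} {x : Plane} (hx : x ∈ disc) (hf : ContinuousAt f x) :
    ContinuousAt (pull f) (chartInv x) := by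
  refine continuous_chartJac.continuousAt.smul (ContinuousAt.comp ?_ continuous_chart.continuousAt)
  rwa [chart_chartInv hx]

theorem tendsto_reconstruction [CompleteSpace E] {f : Plane → E} (hf : Integrable (pull f))
    {x : Plane} (hx : x ∈ disc) (hfx : ContinuousAt f x) :
    Tendsto (fun ε : ℝ => reconstruction f ε x) (𝓝[>] 0) (𝓝 (f x)) := by
  have ha := one_sub_norm_sq_pos hx
  have h := ((tendsto_poissonIntegral hf (continuousAt_pull hx hfx)).comp
    (tendsto_mul_nhdsGT_zero (inv_pos.2 ha))).const_smul (chartJac (chartInv x))⁻¹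
  rw [inv_chartJac_smul_pull hx] at h
  refine h.congr' ?_
  filter_upwards [self_mem_nhdsWithin] with ε hε
  rw [reconstruction_eq_poissonIntegral hf hε hx, Function.comp, inv_mul_eq_div]

theorem memLp_pull {f : Plane → E} (hf : MemLp f 2) (hfi : Integrable (pull f)) :
    MemLp (pull f) 2 := by
  refine ⟨hfi.aestronglyMeasurable, ?_⟩
  have h1 : eLpNorm (pull f) 2 volume ^ 2 ≤ eLpNorm f 2 volume ^ 2 := by
    rw [eLpNorm_two_sq, eLpNorm_two_sq]
    calc ∫⁻ y, ‖pull f y‖ₑ ^ 2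
        ≤ ∫⁻ y in univ, ENNReal.ofReal (chartJac y) * ‖f (chart y)‖ₑ ^ 2 := by
          rw [setLIntegral_univ]
          refine lintegral_mono fun y => ?_
          have hJ0 := chartJac_pos y
          have hJ1 : chartJac y ≤ 1 := by
            have := one_le_bracket y
            refine inv_le_one_of_one_le₀ ?_
            nlinarith [mul_nonneg (sub_nonneg.2 this) (sub_nonneg.2 this)]
          rw [pull, enorm_smul, Real.enorm_of_nonneg hJ0.le, mul_pow, ← ENNReal.ofReal_pow hJ0.le]
          gcongr
          nlinarith
      _ = ∫⁻ x in disc, ‖f x‖ₑ ^ 2 := by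
          rw [← lintegral_chart_image MeasurableSet.univ fun x => ‖f x‖ₑ ^ 2, image_chart_univ]
      _ ≤ ∫⁻ x, ‖f x‖ₑ ^ 2 := setLIntegral_le_lintegral _ _
  exact ((ENNReal.pow_le_pow_left_iff two_ne_zero).1 h1).trans_lt hf.2

/-- The disc has finite area, so a square integrable function is integrable on it. -/
theorem integrable_pull {f : Plane → E} (hf : MemLp f 2) : Integrable (pull f) := by
  rw [integrable_pull_iff]
  have : IsFiniteMeasure (volume.restrict disc) := ⟨by
    rw [Measure.restrict_apply_univ]; exact measure_ball_lt_top⟩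
  exact hf.restrict disc |>.integrable one_le_two

theorem continuousOn_chartInv : ContinuousOn chartInv disc := by
  have h : ContinuousOn (fun x : Plane => 1 - ‖x‖ ^ 2) disc := by fun_prop
  exact (continuousOn_const.div h fun x hx => (one_sub_norm_sq_pos hx).ne').smul continuousOn_id

/-- The change of variables by `chart` expresses the `L²` norm of the error on a compact subset `K`
of the disc by the error of a Poisson integral on a compact subset of the plane. -/
theorem tendsto_eLpNorm_reconstruction_sub [CompleteSpace E] {f : Plane → E} (hf : MemLp f 2)
    {K : Set Plane} (hK : IsCompact K) (hKd : K ⊆ disc) :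
    Tendsto (fun ε : ℝ => eLpNorm (fun x => reconstruction f ε x - f x) 2 (volume.restrict K))
      (𝓝[>] 0) (𝓝 0) := by
  have hfi := integrable_pull hf
  set S : Set Plane := chartInv '' K with hSdef
  have hSc : IsCompact S := hK.image_of_continuousOn (continuousOn_chartInv.mono hKd)
  have hKS : chart '' S = K := by
    rw [hSdef, ← image_comp]
    exact (EqOn.image_eq fun x hx => chart_chartInv (hKd hx)).trans (image_id K)
  have hcont : Continuous fun y : Plane => (1 + bracket y) / 2 :=
    (continuous_const.add continuous_bracket).div_const 2
  obtain ⟨C, hC⟩ := hSc.exists_bound_of_continuousOn hcont.continuousOn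
  have hcontJ : Continuous fun y : Plane => (chartJac y)⁻¹ :=
    continuous_chartJac.inv₀ fun y => (chartJac_pos y).ne'
  obtain ⟨D, hD⟩ := hSc.exists_bound_of_continuousOn hcontJ.continuousOn
  have hlim := tendsto_eLpNorm_poissonIntegral_sub hfi (memLp_pull hf hfi) hcont
    (fun y => by have := one_le_bracket y; linarith) hSc.measurableSet
    (fun y hy => (le_abs_self _).trans (hC y hy)) hSc.measure_ne_top
  -- one factor `1 / chartJac` of the squared error cancels the Jacobian, the other is at most `D`
  have hle : ∀ ε : ℝ, 0 < ε →
      eLpNorm (fun x => reconstruction f ε x - f x) 2 (volume.restrict K) ^ 2 ≤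
        ENNReal.ofReal D * eLpNorm (fun y => poissonIntegral (pull f) ((1 + bracket y) / 2 * ε) y -
          pull f y) 2 (volume.restrict S) ^ 2 := by
    intro ε hε
    rw [eLpNorm_two_sq, eLpNorm_two_sq, ← hKS, lintegral_chart_image hSc.measurableSet,
      ← lintegral_const_mul' _ _ ENNReal.ofReal_ne_top]
    refine setLIntegral_mono' hSc.measurableSet fun y hy => ?_
    have hJ := chartJac_pos y
    rw [reconstruction_sub_chart hfi hε, enorm_smul, Real.enorm_of_nonneg (inv_pos.2 hJ).le,
      mul_pow, ← mul_assoc, ← ENNReal.ofReal_pow (inv_pos.2 hJ).le, ← ENNReal.ofReal_mul hJ.le]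
    gcongr
    refine le_trans (le_of_eq ?_) ((le_abs_self _).trans (hD y hy))
    field_simp
  have hsq := ENNReal.Tendsto.const_mul (a := ENNReal.ofReal D) (ENNReal.Tendsto.pow (n := 2) hlim)
    (Or.inr ENNReal.ofReal_ne_top)
  rw [zero_pow two_ne_zero, mul_zero] at hsq
  have h0 : Tendsto (fun ε : ℝ => eLpNorm (fun x => reconstruction f ε x - f x) 2
      (volume.restrict K) ^ 2) (𝓝[>] 0) (𝓝 0) :=
    tendsto_of_tendsto_of_tendsto_of_le_of_le' tendsto_const_nhds hsq
      (Eventually.of_forall fun _ => bot_le)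
      (by filter_upwards [self_mem_nhdsWithin] with ε hε using hle ε hε)
  exact tendsto_zero_of_sq_tendsto_zero h0

end

end EquidistantRadon

end

theorem mainTheorem4 {𝕜 : Type*} [RCLike 𝕜] (f : EquidistantRadon.Plane → 𝕜)
    (hf : MemLp f 2 volume) (hcomp : HasCompactSupport f)
    (hsupp : tsupport f ⊆ EquidistantRadon.disc) :
    -- the integral over the arc defining the transform exists for almost every arc
    (∀ φ : ℝ, ∀ᵐ s : ℝ, IntegrableOn (EquidistantRadon.frIntegrand EquidistantRadon.genFun f s φ)
      (EquidistantRadon.levelCurve EquidistantRadon.disc EquidistantRadon.genFun s φ)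
      (Measure.hausdorffMeasure 1)) ∧
    -- the regularized integrals converge absolutely
    (∀ x ∈ EquidistantRadon.disc, ∀ ε : ℝ, 0 < ε →
      Integrable (fun p : ℝ × ℝ =>
          EquidistantRadon.regInvSq ε (EquidistantRadon.denom x p.1 p.2) •
            EquidistantRadon.funkRadon EquidistantRadon.disc EquidistantRadon.genFun f p.1 p.2)
        ((volume : Measure ℝ).prod (volume.restrict (Ioc 0 (2 * Real.pi))))) ∧
    -- the reconstruction formula, with convergence in local L² of the disc
    (∀ K : Set EquidistantRadon.Plane, IsCompact K → K ⊆ EquidistantRadon.disc →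
      Tendsto (fun ε : ℝ =>
          eLpNorm (fun x => EquidistantRadon.reconstruction f ε x - f x) 2 (volume.restrict K))
        (𝓝[>] 0) (𝓝 0)) ∧
    -- the reconstruction formula at each point of continuity
    (∀ x ∈ EquidistantRadon.disc, ContinuousAt f x →
      Tendsto (fun ε : ℝ => EquidistantRadon.reconstruction f ε x) (𝓝[>] 0) (𝓝 (f x))) := by
  have hfi := EquidistantRadon.integrable_pull hf
  exact ⟨EquidistantRadon.ae_integrableOn_levelCurve hfi,
    fun x _ ε hε => EquidistantRadon.integrable_regInvSq_smul_funkRadon hfi hε x _,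
    fun K hK hKd => EquidistantRadon.tendsto_eLpNorm_reconstruction_sub hf hK hKd,
    fun x hx hfx => EquidistantRadon.tendsto_reconstruction hfi hx hfx⟩
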